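/- Let $V$ be a finite-dimensional real Euclidean space with inner product $\langle\cdot,\cdot\rangle$, and for $0\neq\alpha\in V$ let $s_\alpha$ be the orthogonal reflection $s_\alpha(v)=v-\frac{2\langle v,\alpha\rangle}{\langle\alpha,\alpha\rangle}\alpha$. Let $\Phi\subset V\setminus\{0\}$ be a root system, i.e. a finite set with $s_\alpha(\beta)\in\Phi$ for all $\alpha,\beta\in\Phi$ and such that $\alpha,c\alpha\in\Phi$ with $c\in\mathbb R$ implies $c=\pm1$ ($\Phi$ need neither span $V$ nor be crystallographic). A simple system of $\Phi$ is a linearly independent subset $\Pi\subseteq\Phi$ such that $\Phi$ is the disjoint union of $\Phi_+:=\Phi\cap\mathbb R_{\ge0}\Pi$ and $-\Phi_+$; fix one. Let $W$ be the group generated by all $s_\alpha$, $\alpha\in\Phi$, and let $S=\{s_\alpha\mid\alpha\in\Pi\}$. For $I\subseteq S$ put $W_I=\langle I\rangle$ and $\Pi_I=\{\alpha\in\Pi\mid s_\alpha\in I\}$. For a subgroup $W'$ of $W$ generated by reflections $s_\alpha$ ($\alpha\in\Phi$), the root system $\Phi_{W'}=\{\alpha\in\Phi\mid s_\alpha\in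 W'\}$ has a unique simple system $\Pi_{W'}$ contained in $\Phi_+$; put $\mathcal C_{W'}=\{v\in V\mid\langle v,\alpha\rangle\ge0\text{ for all }\alpha\in\Pi_{W'}\}$. Let $n\ge1$ and let $W$ act diagonally on $V^n$. For $\mathbf v=(v_1,\dots,v_n)\in V^n$ and $0\le m\le n$ let $W_{\mathbf v,m}$ be the stabiliser in $W$ of $(v_1,\dots,v_m)$ (a subgroup generated by reflections), and let $$\mathcal C^{(n)}=\{\mathbf v\in V^n\mid v_m\in\mathcal C_{W_{\mathbf v,m-1}}\text{ for }m=1,\dots,n\}.$$ For $J\subseteq I\subseteq S$ let $$\mathcal C_{I,J}=\{v\in V\mid\langle\alpha,v\rangle=0\text{ for }\alpha\in\Pi_J,\ \langle\alpha,v\rangle>0\text{ for }\alpha\in\Pi_{I\setminus J}\}.$$ Let $\mathcal I^{(n)}$ be the set of sequences $\mathbf I=(I_0,\dots,I_n)$ of subsets of $S$ with $S=I_0\supseteq I_1\supseteq\dots\supseteq I_n$, and for $\mathbf I\in\mathcal I^{(n)}$ let $$\mathcal X_{\mathbf I}=\mathcal C_{I_0,I_1}\times\mathcal C_{I_1,I_2}\times\dots\times\mathcal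 C_{I_{n-1},I_n}\subseteq V^n.$$ The sets $w(\mathcal X_{\mathbf I})$ with $w\in W$, $\mathbf I\in\mathcal I^{(n)}$ are called the strata of $V^n$. Then: (a) If $\mathbf I\in\mathcal I^{(n)}$, then $\mathcal X_{\mathbf I}\subseteq\mathcal C^{(n)}$. (b) If $\mathbf I\in\mathcal I^{(n)}$, $w\in W$ and $\mathbf v\in w(\mathcal X_{\mathbf I})$, then $\mathrm{Stab}_W(\mathbf v)=wW_{I_n}w^{-1}$. (c) For $v,w\in W$ and $\mathbf I,\mathbf J\in\mathcal I^{(n)}$ the following are equivalent: (i) $v(\mathcal X_{\mathbf I})\cap w(\mathcal X_{\mathbf J})\ne\emptyset$; (ii) $v(\mathcal X_{\mathbf I})=w(\mathcal X_{\mathbf J})$; (iii) $\mathbf I=\mathbf J$ and $v^{-1}w\in W_{I_n}$. (d) If $\mathbf I\in\mathcal I^{(n)}$ and $w\in W$, then the setwise stabiliser of $w(\mathcal X_{\mathbf I})$ in $W$ is $wW_{I_n}w^{-1}$. (e) Each of the sets $\mathcal C^{(n)}$ and $V^n$ is the disjoint union of the strata that it contains. (f) The topological closure of any stratum of $V^n$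 is a union of strata. -/

import Mathlib

open scoped Pointwise

noncomputable section

namespace DiagonalStrata

variable {V : Type*} [NormedAddCommGroup V] [InnerProductSpace ℝ V]

/-- The orthogonal reflection `s_α` in the hyperplane orthogonal to `α`. -/
def refl (α : V) : V ≃ₗ[ℝ] V := ((ℝ ∙ α)ᗮ.reflection).toLinearEquiv

/-- The usual formula `s_α(v) = v - ⟨v, α^∨⟩ α`, where `α^∨ = (2 / ⟨α, α⟩) α`. -/
theorem refl_apply (α v : V) :
    refl α v = v - (inner ℝ v ((2 / inner ℝ α α) • α)) • α := by
  have h : refl α v = (ℝ ∙ α)ᗮ.reflection v := rfl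
  have h2 : (2 : ℕ) • ((inner ℝ α v / ‖α‖ ^ 2) • α) = (2 * (inner ℝ α v / ‖α‖ ^ 2)) • α := by
    rw [two_nsmul, ← add_smul, two_mul]
  have h3 : inner ℝ v ((2 / inner ℝ α α) • α) = 2 * (inner ℝ α v / ‖α‖ ^ 2) := by
    rw [inner_smul_right, real_inner_self_eq_norm_sq, real_inner_comm]
    ring
  rw [h, Submodule.reflection_orthogonal_apply, Submodule.reflection_singleton_apply, h3, neg_sub]
  exact congrArg (v - ·) h2

/-- A (finite, reduced, not necessarily crystallographic, not necessarily spanning) root system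
in the Euclidean space `V`. -/
structure IsRootSystem (Φ : Set V) : Prop where
  finite : Φ.Finite
  zero_notMem : (0 : V) ∉ Φ
  refl_mem : ∀ α ∈ Φ, ∀ β ∈ Φ, refl α β ∈ Φ
  reduced : ∀ α ∈ Φ, ∀ c : ℝ, c • α ∈ Φ → c = 1 ∨ c = -1

/-- `Φ₊ = Φ ∩ ℝ_{≥ 0} Δ`. -/
def posRoots (Φ Δ : Set V) : Set V := Φ ∩ (PointedCone.hull ℝ Δ : Set V)

/-- `Δ` is a simple system of `Φ`: a linearly independent subset of `Φ` such that `Φ` is the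
disjoint union of `Φ₊ = Φ ∩ ℝ_{≥ 0} Δ` and `Φ₋ = -Φ₊`. -/
structure IsSimpleSystem (Φ Δ : Set V) : Prop where
  subset : Δ ⊆ Φ
  linearIndepOn : LinearIndepOn ℝ id Δ
  union_eq : posRoots Φ Δ ∪ -posRoots Φ Δ = Φ
  disjoint : Disjoint (posRoots Φ Δ) (-posRoots Φ Δ)

/-- The group `W` generated by the reflections in the roots. It acts on `V`, diagonally on
`Fin n → V`, and elementwise on subsets of these. -/
def reflGroup (Φ : Set V) : Subgroup (V ≃ₗ[ℝ] V) := Subgroup.closure (refl '' Φ)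

/-- The set `S` of simple reflections, as a subset of `W`. -/
def simpleRefls (Φ Δ : Set V) : Set (reflGroup Φ) := {s | ∃ α ∈ Δ, (s : V ≃ₗ[ℝ] V) = refl α}

/-- For `I ⊆ S`, the set `Δ_I` of simple roots `α` with `s_α ∈ I`. -/
def simpleRootsOf {Φ : Set V} (Δ : Set V) (I : Set (reflGroup Φ)) : Set V :=
  {α ∈ Δ | ∃ s ∈ I, (s : V ≃ₗ[ℝ] V) = refl α}

/-- For `I ⊆ S`, the standard parabolic subgroup `W_I` generated by `I`. -/
def parabolic {Φ : Set V} (I : Set (reflGroup Φ)) : Subgroup (reflGroup Φ) := Subgroup.closure I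

/-- The root system `Φ_{W'} = {α ∈ Φ | s_α ∈ W'}` of a reflection subgroup `W'` of `W`. -/
def subRoots {Φ : Set V} (W' : Subgroup (reflGroup Φ)) : Set V :=
  {α ∈ Φ | ∃ s ∈ W', (s : V ≃ₗ[ℝ] V) = refl α}

/-- The simple system of `Φ_{W'}` contained in `Φ₊`. There is exactly one such simple system, so
that the union is over a single set. -/
def subSimple {Φ : Set V} (Δ : Set V) (W' : Subgroup (reflGroup Φ)) : Set V :=
  ⋃₀ {Γ | IsSimpleSystem (subRoots W') Γ ∧ Γ ⊆ posRoots Φ Δ}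

/-- The fundamental chamber `C_{W'}` of a reflection subgroup `W'` of `W`. -/
def chamber {Φ : Set V} (Δ : Set V) (W' : Subgroup (reflGroup Φ)) : Set V :=
  {v | ∀ α ∈ subSimple Δ W', 0 ≤ inner ℝ v α}

/-- `W_{v, m}`, the stabiliser in `W` of the first `m` entries of `v`. -/
def truncStab (Φ : Set V) {n : ℕ} (v : Fin n → V) (m : ℕ) : Subgroup (reflGroup Φ) :=
  ⨅ i : Fin n, ⨅ _ : (i : ℕ) < m, MulAction.stabilizer (reflGroup Φ) (v i)

/-- The fundamental region `C^(n)` for the diagonal action of `W` on `V^n`. The entries are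
numbered from `0`, so that the entry `v m` is preceded by exactly `m` entries. -/
def fundRegion (Φ Δ : Set V) (n : ℕ) : Set (Fin n → V) :=
  {v | ∀ m : Fin n, v m ∈ chamber Δ (truncStab Φ v m)}

/-- The facet `C_{I,J}`, for `J ⊆ I ⊆ S`. -/
def facet {Φ : Set V} (Δ : Set V) (I J : Set (reflGroup Φ)) : Set V :=
  {v | (∀ α ∈ simpleRootsOf Δ J, inner ℝ α v = 0) ∧
    ∀ α ∈ simpleRootsOf Δ (I \ J), 0 < inner ℝ α v}

/-- The sequences `S = I_0 ⊇ I_1 ⊇ ⋯ ⊇ I_n`. -/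
def chains (Φ Δ : Set V) (n : ℕ) : Set (Fin (n + 1) → Set (reflGroup Φ)) :=
  {I | I 0 = simpleRefls Φ Δ ∧ Antitone I}

/-- `X_I = C_{I_0,I_1} × C_{I_1,I_2} × ⋯ × C_{I_{n-1},I_n}`. -/
def cell {Φ : Set V} (Δ : Set V) {n : ℕ} (I : Fin (n + 1) → Set (reflGroup Φ)) :
    Set (Fin n → V) :=
  Set.univ.pi fun i : Fin n => facet Δ (I i.castSucc) (I i.succ)

/-- The set of all strata `w(X_I)` of `V^n`. -/
def strata (Φ Δ : Set V) (n : ℕ) : Set (Set (Fin n → V)) :=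
  {F | ∃ w : reflGroup Φ, ∃ I ∈ chains Φ Δ n, F = w • cell Δ I}

/-- `A` is the disjoint union of the strata it contains. -/
def IsDisjointUnionOfStrata (Φ Δ : Set V) {n : ℕ} (A : Set (Fin n → V)) : Prop :=
  ⋃₀ {F ∈ strata Φ Δ n | F ⊆ A} = A ∧ {F ∈ strata Φ Δ n | F ⊆ A}.PairwiseDisjoint id

end DiagonalStrata

end

open scoped Pointwise

noncomputable section

namespace DiagonalStrata

variable {V : Type*} [NormedAddCommGroup V] [InnerProductSpace ℝ V]

/-! ### Reflections and words in them. -/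

section Reflections

/-! Everything rests on three classical facts about one vector and one simple system: every orbit
contains a dominant vector (`exists_dominant`), it contains only one, and the stabiliser of a
dominant vector is generated by the simple reflections fixing it (`eq_and_mem_of_dominant`). The
roots of a standard parabolic subgroup `W_I` are those in the span of `Δ_I`, with simple system
`Δ_I`, so the same facts hold inside `W_I`.

They are iterated along the entries of a tuple: once the first `m` entries are settled, only the
parabolic subgroup fixing them may still act, and it moves entry `m` into its own chamber. This
gives existence, uniqueness and stabilisers for `IsDominant` tuples. By `mem_cell_iff` a cell
consists of the dominant tuples with a prescribed chain of simple reflections fixing their initial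
segments, so (a)-(e) follow.

For (f), the closure of a cell is cut out by the weak forms of its inequalities. Along a stratum the
first nonzero pairing of a root with the entries has constant sign (`inner_nonneg_of_mem_cell`).
Hence a stratum that meets the closure of a cell lies in it. -/

theorem refl_apply_eq (α v : V) :
    refl α v = v - (2 * inner ℝ α v / inner ℝ α α) • α := by
  rw [refl_apply, inner_smul_right, real_inner_comm α v]
  congr 2
  ring

theorem inner_refl_refl (α x y : V) : inner ℝ (refl α x) (refl α y) = inner ℝ x y :=
  (ℝ ∙ α)ᗮ.reflection.inner_map_map x y

theorem refl_refl (α x : V) : refl α (refl α x) = x :=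
  (ℝ ∙ α)ᗮ.reflection_reflection x

theorem refl_mul_self (α : V) : refl α * refl α = 1 :=
  LinearEquiv.ext fun x => refl_refl α x

theorem inner_refl_left (α x y : V) : inner ℝ (refl α x) y = inner ℝ x (refl α y) := by
  rw [← inner_refl_refl α (refl α x) y, refl_refl]

theorem refl_self {α : V} (hα : α ≠ 0) : refl α α = -α := by
  have h : inner ℝ α α ≠ 0 := inner_self_ne_zero.2 hα
  rw [refl_apply_eq, mul_div_assoc, div_self h]
  module

theorem refl_eq_self_iff {α : V} (hα : α ≠ 0) (v : V) : refl α v = v ↔ inner ℝ α v = 0 := by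
  have h : inner ℝ α α ≠ 0 := inner_self_ne_zero.2 hα
  rw [refl_apply_eq, sub_eq_self, smul_eq_zero]
  simp [hα]

theorem refl_map {w : V ≃ₗ[ℝ] V} (hw : ∀ x y, inner ℝ (w x) (w y) = inner ℝ x y) (α : V) :
    refl (w α) = w * refl α * w⁻¹ := by
  refine LinearEquiv.ext fun x => ?_
  obtain ⟨y, rfl⟩ := w.surjective x
  change _ = w (refl α (w.symm (w y)))
  rw [LinearEquiv.symm_apply_apply, refl_apply_eq, refl_apply_eq, hw, hw, map_sub, map_smul]

theorem inner_map_map_of_mem_closure {A : Set V} {w : V ≃ₗ[ℝ] V}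
    (hw : w ∈ Subgroup.closure (refl '' A)) (x y : V) :
    inner ℝ (w x) (w y) = inner ℝ x y := by
  induction hw using Subgroup.closure_induction generalizing x y with
  | mem w hw => obtain ⟨α, -, rfl⟩ := hw; exact inner_refl_refl α x y
  | one => rfl
  | mul a b _ _ iha ihb => exact (iha _ _).trans (ihb _ _)
  | inv a _ iha =>
    rw [← iha]
    change inner ℝ (a (a.symm x)) (a (a.symm y)) = _
    simp

theorem apply_eq_self_of_mem_closure {A : Set V} {w : V ≃ₗ[ℝ] V}
    (hw : w ∈ Subgroup.closure (refl '' A)) {v : V} (hv : ∀ α ∈ A, inner ℝ α v = 0) :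
    w v = v := by
  have h : Subgroup.closure (refl '' A) ≤ MulAction.stabilizer (V ≃ₗ[ℝ] V) v := by
    rw [Subgroup.closure_le]
    rintro _ ⟨α, hα, rfl⟩
    change refl α v = v
    rw [refl_apply_eq, hv α hα]
    simp
  exact h hw

theorem exists_list_of_mem_closure {A : Set V} {w : V ≃ₗ[ℝ] V}
    (hw : w ∈ Subgroup.closure (refl '' A)) :
    ∃ l : List V, (∀ α ∈ l, α ∈ A) ∧ (l.map refl).prod = w := by
  induction hw using Subgroup.closure_induction with
  | mem w hw => obtain ⟨α, hα, rfl⟩ := hw; exact ⟨[α], by simpa using hα, by simp⟩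
  | one => exact ⟨[], by simp, by simp⟩
  | mul a b _ _ iha ihb =>
    obtain ⟨l, hl, rfl⟩ := iha
    obtain ⟨l', hl', rfl⟩ := ihb
    refine ⟨l ++ l', fun α hα => ?_, by simp⟩
    rcases List.mem_append.1 hα with h | h
    exacts [hl α h, hl' α h]
  | inv a _ iha =>
    obtain ⟨l, hl, rfl⟩ := iha
    refine ⟨l.reverse, fun α hα => hl α (List.mem_reverse.1 hα), ?_⟩
    rw [List.prod_inv_reverse, List.map_reverse, List.map_map]
    rfl

theorem list_prod_mem_closure {A : Set V} {l : List V} (hl : ∀ α ∈ l, α ∈ A) :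
    (l.map refl).prod ∈ Subgroup.closure (refl '' A) := by
  refine Subgroup.list_prod_mem _ fun x hx => ?_
  obtain ⟨α, hα, rfl⟩ := List.mem_map.1 hx
  exact Subgroup.subset_closure ⟨α, hl α hα, rfl⟩

end Reflections

/-! ### Cones, dual families and coordinates. -/

section Cones

theorem inner_nonneg_of_mem_hull {A : Set V} {v : V} (hv : ∀ α ∈ A, 0 ≤ inner ℝ α v) {x : V}
    (hx : x ∈ PointedCone.hull ℝ A) : 0 ≤ inner ℝ x v := by
  induction hx using Submodule.span_induction with
  | mem x hx => exact hv x hx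
  | zero => simp
  | add x y _ _ hx hy => rw [inner_add_left]; exact add_nonneg hx hy
  | smul a x _ hx =>
    change 0 ≤ inner ℝ ((a : ℝ) • x) v
    rw [real_inner_smul_left]
    exact mul_nonneg a.2 hx

theorem mem_span_of_mem_hull {A : Set V} {x : V} (hx : x ∈ PointedCone.hull ℝ A) :
    x ∈ Submodule.span ℝ A := by
  induction hx using Submodule.span_induction with
  | mem x hx => exact Submodule.subset_span hx
  | zero => simp
  | add x y _ _ hx hy => exact add_mem hx hy
  | smul a x _ hx => exact Submodule.smul_mem _ (a : ℝ) hx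

open Classical in
theorem eq_sum_of_mem_span {A : Set V} (hfin : A.Finite) {ω : V → V}
    (hω : ∀ α ∈ A, ∀ β ∈ A, inner ℝ β (ω α) = if β = α then 1 else 0) {x : V}
    (hx : x ∈ Submodule.span ℝ A) :
    x = ∑ α ∈ hfin.toFinset, inner ℝ x (ω α) • α := by
  induction hx using Submodule.span_induction with
  | mem x hx =>
    rw [Finset.sum_eq_single x]
    · rw [hω x hx x hx]; simp
    · intro b hb hbx
      rw [hω b (by simpa using hb) x hx, if_neg hbx.symm, zero_smul]
    · intro h
      exact absurd (hfin.mem_toFinset.2 hx) h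
  | zero => simp
  | add x y _ _ hx hy =>
    simp only [inner_add_left, add_smul, Finset.sum_add_distrib]
    rw [← hx, ← hy]
  | smul a x _ hx =>
    simp only [real_inner_smul_left, mul_smul]
    rw [← Finset.smul_sum, ← hx]

open Classical in
theorem mem_hull_of_mem_span {A : Set V} (hfin : A.Finite) {ω : V → V}
    (hω : ∀ α ∈ A, ∀ β ∈ A, inner ℝ β (ω α) = if β = α then 1 else 0) {x : V}
    (hx : x ∈ Submodule.span ℝ A) (h : ∀ α ∈ A, 0 ≤ inner ℝ x (ω α)) :
    x ∈ PointedCone.hull ℝ A := by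
  rw [eq_sum_of_mem_span hfin hω hx]
  refine Submodule.sum_mem _ fun α hα => ?_
  have hα' : α ∈ A := by simpa using hα
  exact Submodule.smul_mem _ (⟨inner ℝ x (ω α), h α hα'⟩ : {c : ℝ // 0 ≤ c})
    (Submodule.subset_span hα')

variable [FiniteDimensional ℝ V]

/-- Extending `A` to a basis turns the prescribed values into a linear functional, which the inner
product represents by a vector. This yields the fundamental weights, a height function on roots and
points of cells. -/
theorem exists_inner_eq {A : Set V} (hA : LinearIndepOn ℝ id A) (c : V → ℝ) :
    ∃ p : V, ∀ α ∈ A, inner ℝ α p = c α := by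
  let b := Module.Basis.extend hA
  let f : V →ₗ[ℝ] ℝ := b.constr ℝ fun i => c i
  refine ⟨(InnerProductSpace.toDual ℝ V).symm (LinearMap.toContinuousLinearMap f),
    fun α hα => ?_⟩
  rw [real_inner_comm, InnerProductSpace.toDual_symm_apply]
  have h := b.constr_basis ℝ (fun i => c i) ⟨α, hA.subset_extend _ hα⟩
  rw [Module.Basis.extend_apply_self] at h
  exact h

open Classical in
/-- The fundamental weights: a family of vectors dual to a linearly independent set. -/
theorem exists_dual {A : Set V} (hA : LinearIndepOn ℝ id A) :
    ∃ ω : V → V, ∀ α ∈ A, ∀ β ∈ A, inner ℝ β (ω α) = if β = α then 1 else 0 := by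
  choose ω hω using fun α : V => exists_inner_eq hA fun β => if β = α then 1 else 0
  exact ⟨ω, fun α _ β hβ => hω α β hβ⟩

/-- Coordinates with respect to `A` are unique: the dual vectors read off the coefficients of `x` on
`B`, and these are nonnegative because `x` lies in the cone of `A`. -/
theorem mem_hull_of_mem_span_of_subset {A B : Set V} (hfin : A.Finite)
    (hA : LinearIndepOn ℝ id A) (hBA : B ⊆ A) {x : V} (hx : x ∈ PointedCone.hull ℝ A)
    (hxB : x ∈ Submodule.span ℝ B) : x ∈ PointedCone.hull ℝ B := by
  classical
  obtain ⟨ω, hω⟩ := exists_dual hA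
  refine mem_hull_of_mem_span (hfin.subset hBA)
    (fun α hα β hβ => hω α (hBA hα) β (hBA hβ)) hxB fun α hα => ?_
  refine inner_nonneg_of_mem_hull (fun β hβ => ?_) hx
  rw [hω α (hBA hα) β hβ]
  split_ifs <;> norm_num

end Cones

/-! ### Root systems and their sections by subspaces. -/

namespace IsRootSystem

variable {Φ : Set V}

theorem ne_zero (hΦ : IsRootSystem Φ) {α : V} (hα : α ∈ Φ) : α ≠ 0 :=
  fun h => hΦ.zero_notMem (h ▸ hα)

theorem map_mem (hΦ : IsRootSystem Φ) {w : V ≃ₗ[ℝ] V} (hw : w ∈ reflGroup Φ) {β : V}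
    (hβ : β ∈ Φ) : w β ∈ Φ := by
  obtain ⟨l, hl, rfl⟩ := exists_list_of_mem_closure hw
  induction l with
  | nil => simpa using hβ
  | cons α l ih =>
    have hl' : ∀ γ ∈ l, γ ∈ Φ := fun γ hγ => hl γ (List.mem_cons_of_mem _ hγ)
    rw [List.map_cons, List.prod_cons]
    exact hΦ.refl_mem α (hl α List.mem_cons_self) _ (ih hl' (list_prod_mem_closure hl'))

theorem inter_span (hΦ : IsRootSystem Φ) (Γ : Set V) :
    IsRootSystem (Φ ∩ (Submodule.span ℝ Γ : Set V)) where
  finite := hΦ.finite.subset Set.inter_subset_left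
  zero_notMem h := hΦ.zero_notMem h.1
  refl_mem α hα β hβ := by
    refine ⟨hΦ.refl_mem α hα.1 β hβ.1, ?_⟩
    rw [refl_apply_eq]
    exact sub_mem hβ.2 (Submodule.smul_mem _ _ hα.2)
  reduced α hα c hc := hΦ.reduced α hα.1 c hc.1

end IsRootSystem

/-! ### Simple systems: exchange, generation, dominance. -/

namespace IsSimpleSystem

variable {Φ Δ : Set V}

theorem mem_posRoots (hΔ : IsSimpleSystem Φ Δ) {α : V} (hα : α ∈ Δ) : α ∈ posRoots Φ Δ :=
  ⟨hΔ.subset hα, Submodule.subset_span hα⟩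

theorem mem_or_neg_mem (hΔ : IsSimpleSystem Φ Δ) {α : V} (hα : α ∈ Φ) :
    α ∈ posRoots Φ Δ ∨ -α ∈ posRoots Φ Δ := by
  rw [← hΔ.union_eq] at hα
  exact hα

theorem neg_notMem (hΔ : IsSimpleSystem Φ Δ) {α : V} (hα : α ∈ posRoots Φ Δ) :
    -α ∉ posRoots Φ Δ :=
  fun h => Set.disjoint_left.1 hΔ.disjoint hα h

theorem finite (hΔ : IsSimpleSystem Φ Δ) (hΦ : IsRootSystem Φ) : Δ.Finite :=
  hΦ.finite.subset hΔ.subset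

theorem closure_le (hΔ : IsSimpleSystem Φ Δ) :
    Subgroup.closure (refl '' Δ) ≤ reflGroup Φ :=
  Subgroup.closure_mono (Set.image_mono hΔ.subset)

variable [FiniteDimensional ℝ V]

/-- Positivity in the section is positivity in `Φ`, by uniqueness of coordinates. This lets every
result on simple systems be reused inside a parabolic subgroup. -/
theorem inter_span (hΔ : IsSimpleSystem Φ Δ) (hΦ : IsRootSystem Φ) {Γ : Set V} (hΓ : Γ ⊆ Δ) :
    IsSimpleSystem (Φ ∩ (Submodule.span ℝ Γ : Set V)) Γ := by
  have hpos : posRoots (Φ ∩ (Submodule.span ℝ Γ : Set V)) Γ =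
      posRoots Φ Δ ∩ (Submodule.span ℝ Γ : Set V) := by
    ext x
    refine ⟨fun h => ⟨⟨h.1.1, Submodule.span_mono hΓ h.2⟩, h.1.2⟩, fun h => ⟨⟨h.1.1, h.2⟩, ?_⟩⟩
    exact mem_hull_of_mem_span_of_subset (hΔ.finite hΦ) hΔ.linearIndepOn hΓ h.1.2 h.2
  refine ⟨fun α hα => ⟨hΔ.subset (hΓ hα), Submodule.subset_span hα⟩,
    hΔ.linearIndepOn.mono hΓ, ?_, ?_⟩
  · ext x
    rw [hpos]
    conv_rhs => rw [← hΔ.union_eq]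
    simp only [Set.mem_union, Set.mem_inter_iff, Set.mem_neg, SetLike.mem_coe, neg_mem_iff]
    tauto
  · rw [hpos]
    refine Set.disjoint_left.2 fun x hx hx' => ?_
    exact hΔ.neg_notMem hx.1 hx'.1

/-- Reducedness gives `γ` a positive coefficient at some simple root other than `α`. The reflection
changes only the coefficient at `α`, so the image still has a positive coefficient and cannot be
negative. -/
theorem refl_mem_posRoots (hΔ : IsSimpleSystem Φ Δ) (hΦ : IsRootSystem Φ) {α γ : V}
    (hα : α ∈ Δ) (hγ : γ ∈ posRoots Φ Δ) (hne : γ ≠ α) : refl α γ ∈ posRoots Φ Δ := by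
  classical
  obtain ⟨ω, hω⟩ := exists_dual hΔ.linearIndepOn
  have hnn : ∀ β ∈ Δ, ∀ x ∈ posRoots Φ Δ, 0 ≤ inner ℝ x (ω β) := by
    intro β hβ x hx
    refine inner_nonneg_of_mem_hull (fun δ hδ => ?_) hx.2
    rw [hω β hβ δ hδ]
    split_ifs <;> norm_num
  obtain ⟨β, hβ, hβα, hpos⟩ : ∃ β ∈ Δ, β ≠ α ∧ 0 < inner ℝ γ (ω β) := by
    by_contra! hcon
    have hz : ∀ β ∈ Δ, β ≠ α → inner ℝ γ (ω β) = 0 := fun β hβ hβα =>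
      le_antisymm (hcon β hβ hβα) (hnn β hβ γ hγ)
    have hsum := eq_sum_of_mem_span (hΔ.finite hΦ) hω (mem_span_of_mem_hull hγ.2)
    rw [Finset.sum_eq_single α] at hsum
    · have hc := hΦ.reduced α (hΔ.subset hα) (inner ℝ γ (ω α)) (hsum ▸ hγ.1)
      rcases hc with hc | hc
      · rw [hc, one_smul] at hsum
        exact hne hsum
      · have := hnn α hα γ hγ
        linarith
    · intro b hb hbα
      rw [hz b (by simpa using hb) hbα, zero_smul]
    · intro h
      exact absurd ((hΔ.finite hΦ).mem_toFinset.2 hα) h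
  rcases hΔ.mem_or_neg_mem (hΦ.refl_mem α (hΔ.subset hα) γ hγ.1) with h | h
  · exact h
  · have h1 := hnn β hβ _ h
    rw [refl_apply_eq, inner_neg_left, inner_sub_left, real_inner_smul_left, hω β hβ α hα,
      if_neg hβα.symm] at h1
    linarith

/-- The exchange condition. -/
theorem exists_list_prod_mul_refl_eq (hΔ : IsSimpleSystem Φ Δ) (hΦ : IsRootSystem Φ) {α : V}
    (hα : α ∈ Δ) (l : List V) (hl : ∀ β ∈ l, β ∈ Δ)
    (hneg : (l.map refl).prod α ∉ posRoots Φ Δ) :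
    ∃ l' : List V, (∀ β ∈ l', β ∈ Δ) ∧ l'.length + 1 = l.length ∧
      (l.map refl).prod * refl α = (l'.map refl).prod := by
  induction l with
  | nil => exact absurd (hΔ.mem_posRoots hα) hneg
  | cons β l ih =>
    have hl' : ∀ γ ∈ l, γ ∈ Δ := fun γ hγ => hl γ (List.mem_cons_of_mem _ hγ)
    have hβ : β ∈ Δ := hl β List.mem_cons_self
    by_cases hγ : (l.map refl).prod α ∈ posRoots Φ Δ
    · have heq : (l.map refl).prod α = β := by
        by_contra hne
        refine hneg ?_
        rw [List.map_cons, List.prod_cons]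
        exact hΔ.refl_mem_posRoots hΦ hβ hγ hne
      refine ⟨l, hl', rfl, ?_⟩
      have h := refl_map (inner_map_map_of_mem_closure (list_prod_mem_closure hl')) α
      rw [heq] at h
      rw [List.map_cons, List.prod_cons, h]
      simp only [mul_assoc, inv_mul_cancel_left]
      rw [refl_mul_self, mul_one]
    · obtain ⟨l'', h1, h2, h3⟩ := ih hl' hγ
      refine ⟨β :: l'', ?_, by simp [h2], ?_⟩
      · intro γ hγ
        rcases List.mem_cons.1 hγ with rfl | h
        exacts [hβ, h1 γ h]
      · rw [List.map_cons, List.prod_cons, mul_assoc, h3, List.map_cons, List.prod_cons]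

/-- A positive root violating this with least height would have positive inner product with some
simple `α`. Reflecting in `α` gives a lower positive root whose reflection is conjugate to the
original one by `s_α`. -/
theorem refl_mem_closure (hΔ : IsSimpleSystem Φ Δ) (hΦ : IsRootSystem Φ) {β : V} (hβ : β ∈ Φ) :
    refl β ∈ Subgroup.closure (refl '' Δ) := by
  -- Pairing with `ρ` is the height: every simple root has height 1.
  obtain ⟨ρ, hρ⟩ := exists_inner_eq hΔ.linearIndepOn fun _ => (1 : ℝ)
  have key : ∀ β ∈ posRoots Φ Δ, refl β ∈ Subgroup.closure (refl '' Δ) := by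
    by_contra! hcon
    have hfin : {β ∈ posRoots Φ Δ | refl β ∉ Subgroup.closure (refl '' Δ)}.Finite :=
      hΦ.finite.subset fun x hx => hx.1.1
    obtain ⟨γ, ⟨hγ, hγW⟩, hmin⟩ :=
      Set.exists_min_image _ (fun x => inner ℝ x ρ) hfin hcon
    obtain ⟨α, hα, hpos⟩ : ∃ α ∈ Δ, 0 < inner ℝ α γ := by
      by_contra! h
      have h1 : 0 ≤ inner ℝ γ (-γ) := inner_nonneg_of_mem_hull
        (fun α hα => by rw [inner_neg_right]; have := h α hα; linarith) hγ.2
      rw [inner_neg_right] at h1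
      have h2 := real_inner_self_pos.2 (hΦ.ne_zero hγ.1)
      linarith
    have hsα : refl α ∈ Subgroup.closure (refl '' Δ) := Subgroup.subset_closure ⟨α, hα, rfl⟩
    by_cases hne : γ = α
    · exact hγW (hne ▸ hsα)
    · have hW : refl (refl α γ) ∉ Subgroup.closure (refl '' Δ) := by
        rw [refl_map (inner_refl_refl α)]
        intro h
        rw [Subgroup.mul_mem_cancel_right _ (inv_mem hsα), Subgroup.mul_mem_cancel_left _ hsα] at h
        exact hγW h
      have h1 := hmin _ ⟨hΔ.refl_mem_posRoots hΦ hα hγ hne, hW⟩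
      rw [refl_apply_eq, inner_sub_left, real_inner_smul_left, hρ α hα] at h1
      have h2 := real_inner_self_pos.2 (hΦ.ne_zero (hΔ.subset hα))
      have h3 : 0 < 2 * inner ℝ α γ / inner ℝ α α := by positivity
      linarith
  rcases hΔ.mem_or_neg_mem hβ with h | h
  · exact key β h
  · have h1 : refl (-β) = refl β := LinearEquiv.ext fun x => by
      simp [refl_apply_eq, neg_div, sub_eq_add_neg]
    exact h1 ▸ key _ h

theorem reflGroup_eq_closure (hΔ : IsSimpleSystem Φ Δ) (hΦ : IsRootSystem Φ) :
    reflGroup Φ = Subgroup.closure (refl '' Δ) := by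
  refine le_antisymm ((Subgroup.closure_le _).2 ?_) hΔ.closure_le
  rintro _ ⟨β, hβ, rfl⟩
  exact hΔ.refl_mem_closure hΦ hβ

/-- Induction on the number of positive roots pairing negatively with `v`. Reflecting in a simple
such root `α` lowers it, since `s_α` permutes the positive roots other than `α`. -/
theorem exists_dominant (hΔ : IsSimpleSystem Φ Δ) (hΦ : IsRootSystem Φ) (v : V) :
    ∃ w ∈ Subgroup.closure (refl '' Δ), ∀ α ∈ Δ, 0 ≤ inner ℝ α (w v) := by
  have hfin : ∀ v : V, {β ∈ posRoots Φ Δ | inner ℝ β v < 0}.Finite := fun v =>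
    hΦ.finite.subset fun x hx => hx.1.1
  induction h : {β ∈ posRoots Φ Δ | inner ℝ β v < 0}.ncard using Nat.strong_induction_on
    generalizing v with
  | _ k ih =>
    by_cases hv : ∀ α ∈ Δ, 0 ≤ inner ℝ α v
    · exact ⟨1, one_mem _, hv⟩
    · push Not at hv
      obtain ⟨α, hα, hneg⟩ := hv
      have hα0 := hΦ.ne_zero (hΔ.subset hα)
      have hsub : refl α '' {β ∈ posRoots Φ Δ | inner ℝ β (refl α v) < 0} ⊂
          {β ∈ posRoots Φ Δ | inner ℝ β v < 0} := by
        refine (Set.ssubset_iff_of_subset ?_).2 ⟨α, ⟨hΔ.mem_posRoots hα, hneg⟩, ?_⟩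
        · rintro _ ⟨β, ⟨hβ, hβv⟩, rfl⟩
          refine ⟨hΔ.refl_mem_posRoots hΦ hα hβ ?_, by rwa [inner_refl_left]⟩
          rintro rfl
          rw [← inner_refl_left, refl_self hα0, inner_neg_left] at hβv
          linarith
        · rintro ⟨β, ⟨hβ, -⟩, hβα⟩
          have h1 : β = -α := by rw [← refl_refl α β, hβα, refl_self hα0]
          exact hΔ.neg_notMem (hΔ.mem_posRoots hα) (h1 ▸ hβ)
      have hlt := Set.ncard_lt_ncard hsub (hfin v)
      rw [Set.ncard_image_of_injective _ (refl α).injective, h] at hlt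
      obtain ⟨w, hw, hwv⟩ := ih _ hlt (refl α v) rfl
      exact ⟨w * refl α, mul_mem hw (Subgroup.subset_closure ⟨α, hα, rfl⟩), hwv⟩

/-- Two dominant vectors in the same orbit coincide, and an element fixing a dominant vector is
a product of simple reflections fixing it. -/
theorem eq_and_mem_of_dominant (hΔ : IsSimpleSystem Φ Δ) (hΦ : IsRootSystem Φ)
    {w : V ≃ₗ[ℝ] V} (hw : w ∈ Subgroup.closure (refl '' Δ)) {v : V}
    (hv : ∀ α ∈ Δ, 0 ≤ inner ℝ α v) (hwv : ∀ α ∈ Δ, 0 ≤ inner ℝ α (w v)) :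
    w v = v ∧ w ∈ Subgroup.closure (refl '' {α ∈ Δ | inner ℝ α v = 0}) := by
  obtain ⟨l, hl, rfl⟩ := exists_list_of_mem_closure hw
  clear hw
  induction h : l.length using Nat.strong_induction_on generalizing l with
  | _ k ih =>
    rcases List.eq_nil_or_concat' l with rfl | ⟨l, α, rfl⟩
    · exact ⟨rfl, one_mem _⟩
    have hα : α ∈ Δ := hl α (by simp)
    have hl' : ∀ β ∈ l, β ∈ Δ := fun β hβ => hl β (by simp [hβ])
    have hprod : ((l ++ [α]).map refl).prod = (l.map refl).prod * refl α := by simp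
    rw [List.length_append, List.length_singleton] at h
    rw [hprod] at hwv ⊢
    -- Let `u` be the word without its last letter. If `u α` is positive, dominance of `u s_α v`
    -- gives `0 ≤ ⟨u α, u s_α v⟩ = -⟨α, v⟩`, so `s_α` fixes `v` and may be dropped. Otherwise the
    -- exchange condition writes the same element as a shorter word.
    by_cases hneg : (l.map refl).prod α ∈ posRoots Φ Δ
    · have h1 : inner ℝ α v = 0 := by
        refine le_antisymm ?_ (hv α hα)
        have h2 := inner_nonneg_of_mem_hull hwv hneg.2
        change 0 ≤ inner ℝ _ ((l.map refl).prod (refl α v)) at h2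
        rw [inner_map_map_of_mem_closure (list_prod_mem_closure hl'), ← inner_refl_left,
          refl_self (hΦ.ne_zero (hΔ.subset hα)), inner_neg_left] at h2
        linarith
      have h3 : ((l.map refl).prod * refl α) v = (l.map refl).prod v :=
        congrArg _ ((refl_eq_self_iff (hΦ.ne_zero (hΔ.subset hα)) v).2 h1)
      rw [h3] at hwv ⊢
      obtain ⟨h4, h5⟩ := ih l.length (by lia) l hl' hwv rfl
      exact ⟨h4, mul_mem h5 (Subgroup.subset_closure ⟨α, ⟨hα, h1⟩, rfl⟩)⟩
    · obtain ⟨l', h1, h2, h3⟩ := hΔ.exists_list_prod_mul_refl_eq hΦ hα l hl' hneg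
      rw [h3] at hwv ⊢
      exact ih l'.length (by lia) l' h1 hwv rfl

/-- The group generated by the reflections in `Γ` fixes the orthogonal complement of `Γ` pointwise,
so `α` is orthogonal to that complement. -/
theorem mem_span_of_refl_mem_closure (hΦ : IsRootSystem Φ) {Γ : Set V} {α : V} (hα : α ∈ Φ)
    (h : refl α ∈ Subgroup.closure (refl '' Γ)) : α ∈ Submodule.span ℝ Γ := by
  rw [← Submodule.orthogonal_orthogonal (Submodule.span ℝ Γ), Submodule.mem_orthogonal]
  intro u hu
  rw [real_inner_comm, ← refl_eq_self_iff (hΦ.ne_zero hα)]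
  exact apply_eq_self_of_mem_closure h fun β hβ =>
    (Submodule.mem_orthogonal _ _).1 hu β (Submodule.subset_span hβ)

end IsSimpleSystem

/-! ### Standard parabolic subgroups, their roots and chambers. -/

section Parabolic

variable {Φ Δ : Set V}

theorem simpleRootsOf_subset (Δ : Set V) (I : Set (reflGroup Φ)) : simpleRootsOf Δ I ⊆ Δ :=
  fun _ h => h.1

theorem simpleRootsOf_mono (Δ : Set V) {I J : Set (reflGroup Φ)} (h : I ⊆ J) :
    simpleRootsOf Δ I ⊆ simpleRootsOf Δ J :=
  fun _ ⟨hα, s, hs, hsα⟩ => ⟨hα, s, h hs, hsα⟩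

theorem mem_simpleRootsOf_diff {I J : Set (reflGroup Φ)} {α : V} :
    α ∈ simpleRootsOf Δ (I \ J) ↔ α ∈ simpleRootsOf Δ I ∧ α ∉ simpleRootsOf Δ J := by
  constructor
  · rintro ⟨hα, s, hs, hsα⟩
    refine ⟨⟨hα, s, hs.1, hsα⟩, ?_⟩
    rintro ⟨-, t, ht, htα⟩
    exact hs.2 (Subtype.ext (hsα.trans htα.symm) ▸ ht)
  · rintro ⟨⟨hα, s, hs, hsα⟩, h⟩
    exact ⟨hα, s, ⟨hs, fun h' => h ⟨hα, s, h', hsα⟩⟩, hsα⟩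

theorem eq_of_simpleRootsOf_eq {I J : Set (reflGroup Φ)} (hI : I ⊆ simpleRefls Φ Δ)
    (hJ : J ⊆ simpleRefls Φ Δ) (h : simpleRootsOf Δ I = simpleRootsOf Δ J) : I = J := by
  have key : ∀ {I J : Set (reflGroup Φ)}, I ⊆ simpleRefls Φ Δ →
      simpleRootsOf Δ I = simpleRootsOf Δ J → I ⊆ J := by
    intro I J hI h s hs
    obtain ⟨α, hα, hsα⟩ := hI hs
    obtain ⟨-, t, ht, htα⟩ : α ∈ simpleRootsOf Δ J := h ▸ ⟨hα, s, hs, hsα⟩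
    exact Subtype.ext (hsα.trans htα.symm) ▸ ht
  exact (key hI h).antisymm (key hJ h.symm)

theorem mem_parabolic_iff {I : Set (reflGroup Φ)} (hI : I ⊆ simpleRefls Φ Δ) (w : reflGroup Φ) :
    w ∈ parabolic I ↔ (w : V ≃ₗ[ℝ] V) ∈ Subgroup.closure (refl '' simpleRootsOf Δ I) := by
  have h : refl '' simpleRootsOf Δ I = (reflGroup Φ).subtype '' I := by
    ext x
    constructor
    · rintro ⟨α, ⟨-, s, hs, hsα⟩, rfl⟩
      exact ⟨s, hs, hsα⟩
    · rintro ⟨s, hs, rfl⟩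
      obtain ⟨α, hα, hsα⟩ := hI hs
      exact ⟨α, ⟨hα, s, hs, hsα⟩, hsα.symm⟩
  rw [h, ← MonoidHom.map_closure]
  exact (Subgroup.mem_map_iff_mem (Subgroup.subtype_injective _)).symm

/-- The reflection in a root, as an element of the reflection group. -/
def rootRefl {α : V} (hα : α ∈ Φ) : reflGroup Φ :=
  ⟨refl α, Subgroup.subset_closure ⟨α, hα, rfl⟩⟩

theorem mem_subRoots_iff {W' : Subgroup (reflGroup Φ)} {α : V} (hα : α ∈ Φ) :
    α ∈ subRoots W' ↔ rootRefl hα ∈ W' := by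
  constructor
  · rintro ⟨-, s, hs, hsα⟩
    exact (Subtype.ext hsα : s = rootRefl hα) ▸ hs
  · exact fun h => ⟨hα, _, h, rfl⟩

variable [FiniteDimensional ℝ V]

theorem parabolic_simpleRefls (hΦ : IsRootSystem Φ) (hΔ : IsSimpleSystem Φ Δ) :
    parabolic (simpleRefls Φ Δ) = ⊤ := by
  refine (Subgroup.eq_top_iff' _).2 fun w => ?_
  have h : simpleRootsOf Δ (simpleRefls Φ Δ) = Δ :=
    (simpleRootsOf_subset _ _).antisymm fun α hα =>
      ⟨hα, rootRefl (hΔ.subset hα), ⟨α, hα, rfl⟩, rfl⟩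
  rw [mem_parabolic_iff (Δ := Δ) subset_rfl, h, ← hΔ.reflGroup_eq_closure hΦ]
  exact w.2

theorem subRoots_parabolic (hΦ : IsRootSystem Φ) (hΔ : IsSimpleSystem Φ Δ)
    {I : Set (reflGroup Φ)} (hI : I ⊆ simpleRefls Φ Δ) :
    subRoots (parabolic I) = Φ ∩ (Submodule.span ℝ (simpleRootsOf Δ I) : Set V) := by
  ext α
  constructor
  · rintro ⟨hα, s, hs, hsα⟩
    rw [mem_parabolic_iff hI, hsα] at hs
    exact ⟨hα, IsSimpleSystem.mem_span_of_refl_mem_closure hΦ hα hs⟩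
  · intro hα
    rw [mem_subRoots_iff hα.1, mem_parabolic_iff hI]
    exact (hΔ.inter_span hΦ (simpleRootsOf_subset Δ I)).refl_mem_closure (hΦ.inter_span _) hα

theorem isSimpleSystem_subRoots_parabolic (hΦ : IsRootSystem Φ) (hΔ : IsSimpleSystem Φ Δ)
    {I : Set (reflGroup Φ)} (hI : I ⊆ simpleRefls Φ Δ) :
    IsSimpleSystem (subRoots (parabolic I)) (simpleRootsOf Δ I) := by
  rw [subRoots_parabolic hΦ hΔ hI]
  exact hΔ.inter_span hΦ (simpleRootsOf_subset Δ I)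

theorem mem_chamber_parabolic_iff (hΦ : IsRootSystem Φ) (hΔ : IsSimpleSystem Φ Δ)
    {I : Set (reflGroup Φ)} (hI : I ⊆ simpleRefls Φ Δ) (v : V) :
    v ∈ chamber Δ (parabolic I) ↔ ∀ α ∈ simpleRootsOf Δ I, 0 ≤ inner ℝ α v := by
  constructor
  · intro hv α hα
    rw [real_inner_comm]
    exact hv α ⟨_, ⟨isSimpleSystem_subRoots_parabolic hΦ hΔ hI,
      fun β hβ => hΔ.mem_posRoots hβ.1⟩, hα⟩
  -- Any admissible `Γ` consists of positive roots in the span of `Δ_I`, hence lies in the cone of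
  -- `Δ_I`; uniqueness of the simple system is not needed.
  · rintro hv α ⟨Γ, ⟨hΓ, hΓpos⟩, hα⟩
    rw [real_inner_comm]
    have h := hΓ.subset hα
    rw [subRoots_parabolic hΦ hΔ hI] at h
    exact inner_nonneg_of_mem_hull hv (mem_hull_of_mem_span_of_subset (hΔ.finite hΦ)
      hΔ.linearIndepOn (simpleRootsOf_subset Δ I) (hΓpos hα).2 h.2)

end Parabolic

/-! ### Dominant tuples and the fundamental region. -/

section Dominant

variable (Φ Δ : Set V) {n : ℕ}

/-- The simple reflections fixing the first `m` entries of `v`. -/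
def stabChain (v : Fin n → V) (m : ℕ) : Set (reflGroup Φ) :=
  {s ∈ simpleRefls Φ Δ | ∀ i : Fin n, (i : ℕ) < m → s • v i = v i}

/-- Each of the first `m` entries of `v` is dominant for the simple roots orthogonal to the
preceding ones. -/
def IsDominant (v : Fin n → V) (m : ℕ) : Prop :=
  ∀ i : Fin n, (i : ℕ) < m → ∀ α ∈ simpleRootsOf Δ (stabChain Φ Δ v i), 0 ≤ inner ℝ α (v i)

variable {Φ Δ}

theorem stabChain_subset (v : Fin n → V) (m : ℕ) : stabChain Φ Δ v m ⊆ simpleRefls Φ Δ :=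
  fun _ h => h.1

theorem stabChain_zero (v : Fin n → V) : stabChain Φ Δ v 0 = simpleRefls Φ Δ :=
  (stabChain_subset v 0).antisymm fun _ hs => ⟨hs, fun _ hi => absurd hi (Nat.not_lt_zero _)⟩

theorem stabChain_anti (v : Fin n → V) {k m : ℕ} (h : k ≤ m) :
    stabChain Φ Δ v m ⊆ stabChain Φ Δ v k :=
  fun _ hs => ⟨hs.1, fun i hi => hs.2 i (hi.trans_le h)⟩

theorem stabChain_congr {v v' : Fin n → V} {m : ℕ} (h : ∀ i : Fin n, (i : ℕ) < m → v i = v' i) :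
    stabChain Φ Δ v m = stabChain Φ Δ v' m := by
  ext s
  refine and_congr_right fun _ => forall_congr' fun i => forall_congr' fun hi => ?_
  rw [h i hi]

theorem IsDominant.mono {v : Fin n → V} {k m : ℕ} (hv : IsDominant Φ Δ v m) (h : k ≤ m) :
    IsDominant Φ Δ v k :=
  fun i hi => hv i (hi.trans_le h)

theorem mem_simpleRootsOf_stabChain (hΦ : IsRootSystem Φ) (hΔ : IsSimpleSystem Φ Δ)
    (v : Fin n → V) (m : ℕ) (α : V) :
    α ∈ simpleRootsOf Δ (stabChain Φ Δ v m) ↔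
      α ∈ Δ ∧ ∀ i : Fin n, (i : ℕ) < m → inner ℝ α (v i) = 0 := by
  constructor
  · rintro ⟨hα, s, hs, hsα⟩
    refine ⟨hα, fun i hi => ?_⟩
    rw [← refl_eq_self_iff (hΦ.ne_zero (hΔ.subset hα)), ← hsα]
    exact hs.2 i hi
  · rintro ⟨hα, h⟩
    exact ⟨hα, rootRefl (hΔ.subset hα), ⟨⟨α, hα, rfl⟩, fun i hi =>
      (refl_eq_self_iff (hΦ.ne_zero (hΔ.subset hα)) _).2 (h i hi)⟩, rfl⟩

theorem smul_eq_of_mem_parabolic_stabChain {v : Fin n → V} {m : ℕ} {w : reflGroup Φ}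
    (hw : w ∈ parabolic (stabChain Φ Δ v m)) (i : Fin n) (hi : (i : ℕ) < m) : w • v i = v i := by
  have h : parabolic (stabChain Φ Δ v m) ≤ MulAction.stabilizer (reflGroup Φ) (v i) :=
    (Subgroup.closure_le _).2 fun s hs => hs.2 i hi
  exact h hw

theorem mem_truncStab {v : Fin n → V} {m : ℕ} {w : reflGroup Φ} :
    w ∈ truncStab Φ v m ↔ ∀ i : Fin n, (i : ℕ) < m → w • v i = v i := by
  simp [truncStab, Subgroup.mem_iInf]

/-- A point determines its chain recursively: a simple root of `I_i` pairs to zero with entry `i` if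
it belongs to `I_{i+1}`, and strictly positively otherwise. -/
theorem mem_cell_iff (hΦ : IsRootSystem Φ) (hΔ : IsSimpleSystem Φ Δ)
    {I : Fin (n + 1) → Set (reflGroup Φ)} (hI : I ∈ chains Φ Δ n) (v : Fin n → V) :
    v ∈ cell Δ I ↔ (∀ k : Fin (n + 1), I k = stabChain Φ Δ v k) ∧ IsDominant Φ Δ v n := by
  have hIS : ∀ k, I k ⊆ simpleRefls Φ Δ := fun k => hI.1 ▸ hI.2 (Fin.zero_le k)
  constructor
  · intro hv
    have hk : ∀ k : Fin (n + 1), I k = stabChain Φ Δ v k := by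
      intro k
      induction k using Fin.induction with
      | zero => rw [hI.1]; exact (stabChain_zero v).symm
      | succ i ih =>
        refine eq_of_simpleRootsOf_eq (hIS _) (stabChain_subset _ _) (Set.ext fun α => ?_)
        have hvi := hv i (Set.mem_univ i)
        rw [mem_simpleRootsOf_stabChain hΦ hΔ]
        constructor
        · intro hα
          refine ⟨hα.1, fun j hj => ?_⟩
          rcases (Nat.lt_succ_iff.1 hj : (j : ℕ) ≤ i).lt_or_eq with hj | hj
          · have h := simpleRootsOf_mono Δ (hI.2 i.castSucc_le_succ) hα
            rw [ih, mem_simpleRootsOf_stabChain hΦ hΔ] at h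
            exact h.2 j hj
          · rw [Fin.ext hj]
            exact hvi.1 α hα
        · rintro ⟨hα, h⟩
          by_contra hcon
          have h1 : α ∈ simpleRootsOf Δ (I i.castSucc) := by
            rw [ih, mem_simpleRootsOf_stabChain hΦ hΔ]
            exact ⟨hα, fun j hj => h j (Nat.lt_succ_of_lt hj)⟩
          exact (hvi.2 α (mem_simpleRootsOf_diff.2 ⟨h1, hcon⟩)).ne' (h i (Nat.lt_succ_self _))
    refine ⟨hk, fun i _ α hα => ?_⟩
    have hvi := hv i (Set.mem_univ i)
    rw [← Fin.val_castSucc i, ← hk] at hα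
    by_cases h : α ∈ simpleRootsOf Δ (I i.succ)
    · exact (hvi.1 α h).ge
    · exact (hvi.2 α (mem_simpleRootsOf_diff.2 ⟨hα, h⟩)).le
  · rintro ⟨hk, hdom⟩ i -
    refine ⟨fun α hα => ?_, fun α hα => ?_⟩
    · rw [hk, mem_simpleRootsOf_stabChain hΦ hΔ] at hα
      exact hα.2 i (Nat.lt_succ_self _)
    · rw [mem_simpleRootsOf_diff, hk, hk] at hα
      refine (hdom i i.2 α hα.1).lt_of_ne' fun h0 => hα.2 ?_
      have h := hα.1
      rw [mem_simpleRootsOf_stabChain hΦ hΔ] at h ⊢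
      refine ⟨h.1, fun j hj => ?_⟩
      rcases (Nat.lt_succ_iff.1 hj : (j : ℕ) ≤ i).lt_or_eq with hj | hj
      · exact h.2 j hj
      · rwa [Fin.ext hj]

theorem stabChain_mem_chains (v : Fin n → V) :
    (fun k : Fin (n + 1) => stabChain Φ Δ v k) ∈ chains Φ Δ n :=
  ⟨stabChain_zero v, fun _ _ h => stabChain_anti v h⟩

theorem IsDominant.mem_cell (hΦ : IsRootSystem Φ) (hΔ : IsSimpleSystem Φ Δ) {v : Fin n → V}
    (hv : IsDominant Φ Δ v n) : v ∈ cell Δ fun k : Fin (n + 1) => stabChain Φ Δ v k :=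
  (mem_cell_iff hΦ hΔ (stabChain_mem_chains v) v).2 ⟨fun _ => rfl, hv⟩

variable [FiniteDimensional ℝ V]

/-- Induction on `m`. The first `m` entries of `v` and `v'` agree and `w` lies in the parabolic
subgroup fixing them, so entry `m` of each tuple is dominant for one common subsystem and
`eq_and_mem_of_dominant` applies there. -/
theorem IsDominant.mem_parabolic_and_eq (hΦ : IsRootSystem Φ) (hΔ : IsSimpleSystem Φ Δ)
    {v v' : Fin n → V} {m : ℕ} (hv : IsDominant Φ Δ v m) (hv' : IsDominant Φ Δ v' m)
    {w : reflGroup Φ} (hw : ∀ i : Fin n, (i : ℕ) < m → w • v i = v' i) :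
    w ∈ parabolic (stabChain Φ Δ v m) ∧ ∀ i : Fin n, (i : ℕ) < m → v i = v' i := by
  induction m with
  | zero =>
    rw [stabChain_zero, parabolic_simpleRefls hΦ hΔ]
    exact ⟨Subgroup.mem_top w, fun i hi => absurd hi (Nat.not_lt_zero _)⟩
  | succ m ih =>
    obtain ⟨hwm, heq⟩ := ih (hv.mono m.le_succ) (hv'.mono m.le_succ)
      fun i hi => hw i (Nat.lt_succ_of_lt hi)
    rw [mem_parabolic_iff (stabChain_subset _ _)] at hwm ⊢
    by_cases hm : m < n
    · have h1 := hv ⟨m, hm⟩ (Nat.lt_succ_self m)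
      have h2 := hv' ⟨m, hm⟩ (Nat.lt_succ_self m)
      rw [← hw ⟨m, hm⟩ (Nat.lt_succ_self m)] at h2
      change ∀ α ∈ simpleRootsOf Δ (stabChain Φ Δ v' m), _ at h2
      rw [← stabChain_congr heq] at h2
      obtain ⟨h3, h4⟩ := (hΔ.inter_span hΦ (simpleRootsOf_subset Δ _)).eq_and_mem_of_dominant
        (hΦ.inter_span _) hwm h1 h2
      constructor
      · refine Subgroup.closure_mono (Set.image_mono fun α hα => ?_) h4
        have h := hα.1
        rw [mem_simpleRootsOf_stabChain hΦ hΔ] at h ⊢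
        refine ⟨h.1, fun j hj => ?_⟩
        rcases (Nat.lt_succ_iff.1 hj).lt_or_eq with hj | hj
        · exact h.2 j hj
        · rw [show j = ⟨m, hm⟩ from Fin.ext hj]
          exact hα.2
      · intro j hj
        rcases (Nat.lt_succ_iff.1 hj).lt_or_eq with hj' | hj'
        · exact heq j hj'
        · rw [← hw j hj, show j = ⟨m, hm⟩ from Fin.ext hj']
          exact h3.symm
    · have hlt : ∀ i : Fin n, (i : ℕ) < m := fun i => i.2.trans_le (not_lt.1 hm)
      refine ⟨?_, fun i _ => heq i (hlt i)⟩
      have h : stabChain Φ Δ v (m + 1) = stabChain Φ Δ v m :=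
        (stabChain_anti v m.le_succ).antisymm fun s hs => ⟨hs.1, fun i _ => hs.2 i (hlt i)⟩
      rwa [h]

theorem IsDominant.truncStab_eq (hΦ : IsRootSystem Φ) (hΔ : IsSimpleSystem Φ Δ)
    {v : Fin n → V} {m : ℕ} (hv : IsDominant Φ Δ v m) :
    truncStab Φ v m = parabolic (stabChain Φ Δ v m) := by
  ext w
  rw [mem_truncStab]
  exact ⟨fun h => (hv.mem_parabolic_and_eq hΦ hΔ hv h).1, smul_eq_of_mem_parabolic_stabChain⟩

/-- The stabiliser of the first entries is known to be standard parabolic only once those entries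
are dominant, hence the induction on their number. -/
theorem mem_fundRegion_iff (hΦ : IsRootSystem Φ) (hΔ : IsSimpleSystem Φ Δ) (v : Fin n → V) :
    v ∈ fundRegion Φ Δ n ↔ IsDominant Φ Δ v n := by
  constructor
  · intro hv
    have key : ∀ m : ℕ, IsDominant Φ Δ v m := by
      intro m
      induction m with
      | zero => exact fun i hi => absurd hi (Nat.not_lt_zero _)
      | succ m ih =>
        intro i hi
        have him := ih.mono (Nat.lt_succ_iff.1 hi)
        have h := hv i
        rw [him.truncStab_eq hΦ hΔ, mem_chamber_parabolic_iff hΦ hΔ (stabChain_subset _ _)] at h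
        exact h
    exact key n
  · intro hv i
    rw [(hv.mono i.2.le).truncStab_eq hΦ hΔ,
      mem_chamber_parabolic_iff hΦ hΔ (stabChain_subset _ _)]
    exact hv i i.2

theorem exists_smul_isDominant (hΦ : IsRootSystem Φ) (hΔ : IsSimpleSystem Φ Δ)
    (v : Fin n → V) (m : ℕ) : ∃ w : reflGroup Φ, IsDominant Φ Δ (w • v) m := by
  induction m with
  | zero => exact ⟨1, fun i hi => absurd hi (Nat.not_lt_zero _)⟩
  | succ m ih =>
    obtain ⟨w, hw⟩ := ih
    by_cases hm : m < n
    -- The correction `u` of entry `m` is taken from the parabolic subgroup fixing the earlier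
    -- entries, so their dominance is kept.
    · obtain ⟨u, hu, hdom⟩ := (hΔ.inter_span hΦ
        (simpleRootsOf_subset Δ (stabChain Φ Δ (w • v) m))).exists_dominant (hΦ.inter_span _)
        ((w • v) ⟨m, hm⟩)
      have huW : u ∈ reflGroup Φ := by
        rw [hΔ.reflGroup_eq_closure hΦ]
        exact Subgroup.closure_mono (Set.image_mono (simpleRootsOf_subset Δ _)) hu
      have hfix : ∀ i : Fin n, (i : ℕ) < m →
          (w • v) i = (((⟨u, huW⟩ : reflGroup Φ) * w) • v) i := by
        intro i hi
        rw [mul_smul]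
        exact (smul_eq_of_mem_parabolic_stabChain
          ((mem_parabolic_iff (stabChain_subset _ _) ⟨u, huW⟩).2 hu) i hi).symm
      refine ⟨⟨u, huW⟩ * w, fun i hi => ?_⟩
      have him : (i : ℕ) ≤ m := Nat.lt_succ_iff.1 hi
      rw [← stabChain_congr fun j hj => hfix j (hj.trans_le him)]
      rcases him.lt_or_eq with h | h
      · rw [← hfix i h]
        exact hw i h
      · rw [show i = ⟨m, hm⟩ from Fin.ext h, mul_smul]
        exact hdom
    · exact ⟨w, fun i _ => hw i (i.2.trans_le (not_lt.1 hm))⟩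

end Dominant

/-! ### Strata, their stabilisers and their closures. -/

section Strata

variable {Φ Δ : Set V} {n : ℕ} {I J : Fin (n + 1) → Set (reflGroup Φ)}

theorem smul_eq_of_mem_parabolic_last (hΦ : IsRootSystem Φ) (hΔ : IsSimpleSystem Φ Δ)
    (hI : I ∈ chains Φ Δ n) {v : Fin n → V} (hv : v ∈ cell Δ I) {w : reflGroup Φ}
    (hw : w ∈ parabolic (I (Fin.last n))) : w • v = v := by
  rw [((mem_cell_iff hΦ hΔ hI v).1 hv).1] at hw
  exact funext fun i => smul_eq_of_mem_parabolic_stabChain hw i i.2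

variable [FiniteDimensional ℝ V]

theorem cell_nonempty (hΔ : IsSimpleSystem Φ Δ) (I : Fin (n + 1) → Set (reflGroup Φ)) :
    (cell Δ I).Nonempty := by
  classical
  -- Entry `i` pairs to 0 with the simple roots of `I_{i+1}` and to 1 with all others.
  choose p hp using fun i : Fin n => exists_inner_eq hΔ.linearIndepOn
    fun α => if α ∈ simpleRootsOf Δ (I i.succ) then (0 : ℝ) else 1
  refine ⟨p, fun i _ => ⟨fun α hα => ?_, fun α hα => ?_⟩⟩
  · rw [hp i α hα.1, if_pos hα]
  · rw [hp i α hα.1, if_neg (mem_simpleRootsOf_diff.1 hα).2]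
    norm_num

theorem eq_and_mem_parabolic_of_smul_mem_cell (hΦ : IsRootSystem Φ) (hΔ : IsSimpleSystem Φ Δ)
    (hI : I ∈ chains Φ Δ n) (hJ : J ∈ chains Φ Δ n) {v : Fin n → V} {w : reflGroup Φ}
    (hv : v ∈ cell Δ I) (hwv : w • v ∈ cell Δ J) :
    I = J ∧ w ∈ parabolic (I (Fin.last n)) := by
  obtain ⟨h1, h2⟩ := (mem_cell_iff hΦ hΔ hI _).1 hv
  obtain ⟨h3, h4⟩ := (mem_cell_iff hΦ hΔ hJ _).1 hwv
  obtain ⟨h5, h6⟩ := h2.mem_parabolic_and_eq hΦ hΔ h4 (w := w) fun i _ => rfl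
  have h7 : v = w • v := funext fun i => h6 i i.2
  refine ⟨funext fun k => ?_, ?_⟩
  · rw [h1, h3, ← h7]
  · rwa [h1]

theorem strata_tfae (hΦ : IsRootSystem Φ) (hΔ : IsSimpleSystem Φ Δ) (v w : reflGroup Φ)
    (hI : I ∈ chains Φ Δ n) (hJ : J ∈ chains Φ Δ n) :
    List.TFAE [v • cell Δ I ∩ w • cell Δ J ≠ ∅, v • cell Δ I = w • cell Δ J,
      I = J ∧ v⁻¹ * w ∈ parabolic (I (Fin.last n))] := by
  tfae_have 3 → 2 := by
    rintro ⟨rfl, h⟩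
    have h1 : (v⁻¹ * w) • cell Δ I = cell Δ I := by
      have h2 : (fun x => (v⁻¹ * w) • x) '' cell Δ I = id '' cell Δ I :=
        Set.image_congr fun x hx => smul_eq_of_mem_parabolic_last hΦ hΔ hI hx h
      rwa [Set.image_id] at h2
    rw [mul_smul, inv_smul_eq_iff] at h1
    exact h1.symm
  tfae_have 2 → 1 := by
    intro h
    rw [h, Set.inter_self]
    exact ((cell_nonempty hΔ J).smul_set).ne_empty
  tfae_have 1 → 3 := by
    intro h
    obtain ⟨_, ⟨a, ha, rfl⟩, ⟨b, hb, hab⟩⟩ := Set.nonempty_iff_ne_empty.2 h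
    have h1 : (v⁻¹ * w) • b = a := by
      rw [mul_smul, inv_smul_eq_iff]
      exact hab
    obtain ⟨rfl, h2⟩ := eq_and_mem_parabolic_of_smul_mem_cell hΦ hΔ hJ hI hb (h1 ▸ ha)
    exact ⟨rfl, h2⟩
  tfae_finish

theorem mem_map_conj_iff {G : Type*} [Group G] (H : Subgroup G) (w u : G) :
    u ∈ H.map (MulAut.conj w).toMonoidHom ↔ w⁻¹ * u * w ∈ H := by
  constructor
  · rintro ⟨x, hx, rfl⟩
    simpa [mul_assoc] using hx
  · exact fun h => ⟨_, h, by simp [mul_assoc]⟩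

theorem stabilizer_of_mem_smul_cell (hΦ : IsRootSystem Φ) (hΔ : IsSimpleSystem Φ Δ)
    (hI : I ∈ chains Φ Δ n) (w : reflGroup Φ) {v : Fin n → V} (hv : v ∈ w • cell Δ I) :
    MulAction.stabilizer (reflGroup Φ) v =
      (parabolic (I (Fin.last n))).map (MulAut.conj w).toMonoidHom := by
  obtain ⟨a, ha, rfl⟩ := hv
  ext u
  rw [mem_map_conj_iff, MulAction.mem_stabilizer_iff]
  have h : u • w • a = w • a ↔ (w⁻¹ * u * w) • a = a := by
    rw [mul_smul, mul_smul, inv_smul_eq_iff]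
  refine h.trans ⟨fun h => ?_, smul_eq_of_mem_parabolic_last hΦ hΔ hI ha⟩
  exact (eq_and_mem_parabolic_of_smul_mem_cell hΦ hΔ hI hI ha (h.symm ▸ ha)).2

theorem stabilizer_smul_cell (hΦ : IsRootSystem Φ) (hΔ : IsSimpleSystem Φ Δ)
    (hI : I ∈ chains Φ Δ n) (w : reflGroup Φ) :
    MulAction.stabilizer (reflGroup Φ) (w • cell Δ I) =
      (parabolic (I (Fin.last n))).map (MulAut.conj w).toMonoidHom := by
  ext u
  -- Positions count from zero: this is the equivalence of equal strata with the group condition,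
  -- for `w` and `u * w`.
  have h := (strata_tfae hΦ hΔ w (u * w) hI hI).out 1 2
  rw [mem_map_conj_iff, MulAction.mem_stabilizer_iff, ← mul_smul, eq_comm, h, mul_assoc]
  simp

theorem strata_pairwiseDisjoint (hΦ : IsRootSystem Φ) (hΔ : IsSimpleSystem Φ Δ) :
    (strata Φ Δ n).PairwiseDisjoint id := by
  rintro _ ⟨v, I, hI, rfl⟩ _ ⟨w, J, hJ, rfl⟩ hne
  by_contra h
  rw [Function.onFun, Set.disjoint_iff_inter_eq_empty] at h
  exact hne (((strata_tfae hΦ hΔ v w hI hJ).out 0 1).1 h)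

theorem exists_stratum (hΦ : IsRootSystem Φ) (hΔ : IsSimpleSystem Φ Δ) (v : Fin n → V) :
    ∃ F ∈ strata Φ Δ n, v ∈ F := by
  obtain ⟨w, hw⟩ := exists_smul_isDominant hΦ hΔ v n
  refine ⟨_, ⟨w⁻¹, _, stabChain_mem_chains (w • v), rfl⟩, ?_⟩
  rw [Set.mem_inv_smul_set_iff]
  exact hw.mem_cell hΦ hΔ

theorem cell_subset_fundRegion (hΦ : IsRootSystem Φ) (hΔ : IsSimpleSystem Φ Δ)
    (hI : I ∈ chains Φ Δ n) : cell Δ I ⊆ fundRegion Φ Δ n :=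
  fun v hv => (mem_fundRegion_iff hΦ hΔ v).2 ((mem_cell_iff hΦ hΔ hI v).1 hv).2

theorem isDisjointUnionOfStrata_fundRegion (hΦ : IsRootSystem Φ) (hΔ : IsSimpleSystem Φ Δ) :
    IsDisjointUnionOfStrata Φ Δ (fundRegion Φ Δ n) := by
  refine ⟨(Set.sUnion_subset fun F hF => hF.2).antisymm fun v hv => ?_,
    (strata_pairwiseDisjoint hΦ hΔ).subset fun F hF => hF.1⟩
  have hI := stabChain_mem_chains (Φ := Φ) (Δ := Δ) v
  exact ⟨_, ⟨⟨1, _, hI, (one_smul _ _).symm⟩, cell_subset_fundRegion hΦ hΔ hI⟩,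
    ((mem_fundRegion_iff hΦ hΔ v).1 hv).mem_cell hΦ hΔ⟩

theorem isDisjointUnionOfStrata_univ (hΦ : IsRootSystem Φ) (hΔ : IsSimpleSystem Φ Δ) :
    IsDisjointUnionOfStrata Φ Δ (Set.univ : Set (Fin n → V)) := by
  refine ⟨Set.eq_univ_of_forall fun v => ?_,
    (strata_pairwiseDisjoint hΦ hΔ).subset fun F hF => hF.1⟩
  obtain ⟨F, hF, hv⟩ := exists_stratum hΦ hΔ v
  exact ⟨F, ⟨hF, Set.subset_univ F⟩, hv⟩

/-- If a root is orthogonal to the first `m` entries of a point of a cell, then it is orthogonal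
to the first `m` entries of every point of that cell. -/
theorem inner_eq_zero_of_mem_cell (hΦ : IsRootSystem Φ) (hΔ : IsSimpleSystem Φ Δ)
    (hI : I ∈ chains Φ Δ n) {a b : Fin n → V} (ha : a ∈ cell Δ I) (hb : b ∈ cell Δ I)
    {γ : V} (hγ : γ ∈ Φ) {m : ℕ} (hm : m ≤ n)
    (h : ∀ j : Fin n, (j : ℕ) < m → inner ℝ γ (a j) = 0) :
    ∀ j : Fin n, (j : ℕ) < m → inner ℝ γ (b j) = 0 := by
  obtain ⟨ha1, ha2⟩ := (mem_cell_iff hΦ hΔ hI a).1 ha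
  obtain ⟨hb1, hb2⟩ := (mem_cell_iff hΦ hΔ hI b).1 hb
  -- Both stabilisers are the parabolic subgroup of the same `I_m`.
  have heq : truncStab Φ a m = truncStab Φ b m := by
    rw [(ha2.mono hm).truncStab_eq hΦ hΔ, (hb2.mono hm).truncStab_eq hΦ hΔ]
    have h1 := ha1 ⟨m, Nat.lt_succ_of_le hm⟩
    rw [hb1] at h1
    exact congrArg parabolic h1.symm
  have hmem : rootRefl hγ ∈ truncStab Φ a m :=
    mem_truncStab.2 fun j hj => (refl_eq_self_iff (hΦ.ne_zero hγ) _).2 (h j hj)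
  rw [heq, mem_truncStab] at hmem
  exact fun j hj => (refl_eq_self_iff (hΦ.ne_zero hγ) _).1 (hmem j hj)

/-- The sign of the first nonzero pairing of a root with the entries of a point of a cell does
not depend on the point. -/
theorem inner_nonneg_of_mem_cell (hΦ : IsRootSystem Φ) (hΔ : IsSimpleSystem Φ Δ)
    (hI : I ∈ chains Φ Δ n) {a b : Fin n → V} (ha : a ∈ cell Δ I) (hb : b ∈ cell Δ I)
    {γ : V} (hγ : γ ∈ Φ) (i : Fin n) (h : ∀ j < i, inner ℝ γ (a j) = 0)
    (hi : 0 ≤ inner ℝ γ (a i)) : 0 ≤ inner ℝ γ (b i) := by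
  obtain ⟨ha1, ha2⟩ := (mem_cell_iff hΦ hΔ hI a).1 ha
  obtain ⟨hb1, hb2⟩ := (mem_cell_iff hΦ hΔ hI b).1 hb
  have hab : stabChain Φ Δ b i = stabChain Φ Δ a i := by
    have h1 := ha1 i.castSucc
    rw [hb1] at h1
    exact h1
  have hda := ha2 i i.2
  have hdb := hb2 i i.2
  rw [hab] at hdb
  have hmem : γ ∈ subRoots (parabolic (stabChain Φ Δ a i)) := by
    rw [mem_subRoots_iff hγ, ← (ha2.mono i.2.le).truncStab_eq hΦ hΔ, mem_truncStab]
    exact fun j hj => (refl_eq_self_iff (hΦ.ne_zero hγ) _).2 (h j hj)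
  rcases (isSimpleSystem_subRoots_parabolic hΦ hΔ (stabChain_subset a i)).mem_or_neg_mem hmem
    with hpos | hneg
  · exact inner_nonneg_of_mem_hull hdb hpos.2
  -- For negative `γ` the pairing with `a i` is also nonpositive, hence zero, and the vanishing
  -- carries over to `b`.
  · have h1 := inner_nonneg_of_mem_hull hda hneg.2
    rw [inner_neg_left] at h1
    refine (inner_eq_zero_of_mem_cell hΦ hΔ hI ha hb hγ (m := i + 1) i.2 (fun j hj => ?_) i
      (Nat.lt_succ_self _)).ge
    rcases (Nat.lt_succ_iff.1 hj).lt_or_eq with hj | hj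
    · exact h j hj
    · rw [Fin.ext hj]
      linarith

/-- The weak conditions are closed. Conversely, adding a small positive multiple of a point of the
cell makes the required inequalities strict and keeps the equalities. -/
theorem mem_closure_cell_iff (hΔ : IsSimpleSystem Φ Δ)
    (I : Fin (n + 1) → Set (reflGroup Φ)) (v : Fin n → V) :
    v ∈ closure (cell Δ I) ↔ ∀ i : Fin n, (∀ α ∈ simpleRootsOf Δ (I i.succ), inner ℝ α (v i) = 0) ∧
      ∀ α ∈ simpleRootsOf Δ (I i.castSucc), 0 ≤ inner ℝ α (v i) := by
  constructor
  · intro hv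
    have hclosed : IsClosed {v : Fin n → V | ∀ i : Fin n,
        (∀ α ∈ simpleRootsOf Δ (I i.succ), inner ℝ α (v i) = 0) ∧
        ∀ α ∈ simpleRootsOf Δ (I i.castSucc), 0 ≤ inner ℝ α (v i)} := by
      simp only [Set.ofPred_forall, Set.ofPred_and]
      refine isClosed_iInter fun i => (isClosed_iInter fun α => isClosed_iInter fun _ => ?_).inter
        (isClosed_iInter fun α => isClosed_iInter fun _ => ?_)
      · exact isClosed_eq (by fun_prop) continuous_const
      · exact isClosed_le continuous_const (by fun_prop)
    refine closure_minimal (fun x hx i => ?_) hclosed hv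
    have hxi := hx i (Set.mem_univ i)
    refine ⟨hxi.1, fun α hα => ?_⟩
    by_cases h : α ∈ simpleRootsOf Δ (I i.succ)
    · exact (hxi.1 α h).ge
    · exact (hxi.2 α (mem_simpleRootsOf_diff.2 ⟨hα, h⟩)).le
  · intro hv
    obtain ⟨p, hp⟩ := cell_nonempty hΔ I
    have hlim : Filter.Tendsto (fun t : ℝ => v + t • p) (nhdsWithin 0 (Set.Ioi 0)) (nhds v) := by
      have h : Continuous fun t : ℝ => v + t • p := by fun_prop
      have h' := h.tendsto 0
      rw [zero_smul, add_zero] at h'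
      exact h'.mono_left nhdsWithin_le_nhds
    refine mem_closure_of_tendsto hlim ?_
    filter_upwards [self_mem_nhdsWithin] with t ht i _
    have hpi := hp i (Set.mem_univ i)
    refine ⟨fun α hα => ?_, fun α hα => ?_⟩
    · rw [Pi.add_apply, Pi.smul_apply, inner_add_right, inner_smul_right, (hv i).1 α hα,
        hpi.1 α hα]
      simp
    · rw [Pi.add_apply, Pi.smul_apply, inner_add_right, inner_smul_right]
      have h1 := (hv i).2 α (mem_simpleRootsOf_diff.1 hα).1
      have h2 := mul_pos (Set.mem_Ioi.1 ht) (hpi.2 α hα)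
      linarith

/-- After moving `u` to the other side, the closure conditions become vanishing and sign conditions
on the roots `u⁻¹ α`. Each sign condition concerns the first entry whose pairing may be nonzero, so
it passes from `a` to every `b` in the cell. -/
theorem smul_cell_subset_closure_cell (hΦ : IsRootSystem Φ) (hΔ : IsSimpleSystem Φ Δ)
    (hI : I ∈ chains Φ Δ n) (hJ : J ∈ chains Φ Δ n) (u : reflGroup Φ) {x : Fin n → V}
    (hx : x ∈ closure (cell Δ I)) (hxu : x ∈ u • cell Δ J) :
    u • cell Δ J ⊆ closure (cell Δ I) := by
  obtain ⟨a, ha, rfl⟩ := hxu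
  rintro _ ⟨b, hb, rfl⟩
  rw [mem_closure_cell_iff hΔ] at hx ⊢
  have hinner : ∀ α y : V, inner ℝ α (u • y) = inner ℝ (u⁻¹ • α) y := fun α y => by
    have h := inner_map_map_of_mem_closure u.2 (u⁻¹ • α) y
    rw [← h]
    change _ = inner ℝ (u • u⁻¹ • α) (u • y)
    rw [smul_inv_smul]
  have hzero : ∀ i j : Fin n, j ≤ i → ∀ α ∈ simpleRootsOf Δ (I i.succ),
      inner ℝ (u⁻¹ • α) (a j) = 0 := by
    intro i j hji α hα
    rw [← hinner]
    exact (hx j).1 α (simpleRootsOf_mono Δ (hI.2 (Fin.succ_le_succ_iff.2 hji)) hα)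
  -- Roots of `I_i` are orthogonal only to the entries strictly before `i`, those of `I_{i+1}` also
  -- to entry `i`.
  have hzero' : ∀ i j : Fin n, j < i → ∀ α ∈ simpleRootsOf Δ (I i.castSucc),
      inner ℝ (u⁻¹ • α) (a j) = 0 := by
    intro i j hji α hα
    rw [← hinner]
    exact (hx j).1 α (simpleRootsOf_mono Δ (hI.2 (Fin.succ_le_castSucc_iff.2 hji)) hα)
  have hroot : ∀ α ∈ Δ, u⁻¹ • α ∈ Φ := fun α hα => hΦ.map_mem (u⁻¹).2 (hΔ.subset hα)
  refine fun i => ⟨fun α hα => ?_, fun α hα => ?_⟩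
  · change inner ℝ α (u • b i) = 0
    rw [hinner]
    exact inner_eq_zero_of_mem_cell hΦ hΔ hJ ha hb (hroot α hα.1) (m := i + 1) i.2
      (fun j hj => hzero i j (Nat.lt_succ_iff.1 hj) α hα) i (Nat.lt_succ_self _)
  · change 0 ≤ inner ℝ α (u • b i)
    rw [hinner]
    refine inner_nonneg_of_mem_cell hΦ hΔ hJ ha hb (hroot α hα.1) i
      (fun j hj => hzero' i j hj α hα) ?_
    rw [← hinner]
    exact (hx i).2 α hα

theorem closure_smul_set (w : reflGroup Φ) (A : Set (Fin n → V)) :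
    closure (w • A) = w • closure A := by
  have : ContinuousConstSMul (reflGroup Φ) V :=
    ⟨fun w => ((w : V ≃ₗ[ℝ] V) : V →ₗ[ℝ] V).continuous_of_finiteDimensional⟩
  exact closure_smul w A

theorem exists_closure_eq_sUnion (hΦ : IsRootSystem Φ) (hΔ : IsSimpleSystem Φ Δ)
    {F : Set (Fin n → V)} (hF : F ∈ strata Φ Δ n) :
    ∃ 𝒢 ⊆ strata Φ Δ n, closure F = ⋃₀ 𝒢 := by
  obtain ⟨w, I, hI, rfl⟩ := hF
  -- The strata inside the closure cover it, since each of its points lies in some stratum and a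
  -- stratum meeting the closure is contained in it.
  refine ⟨{G ∈ strata Φ Δ n | G ⊆ closure (w • cell Δ I)}, fun G hG => hG.1,
    Set.Subset.antisymm (fun x hx => ?_) (Set.sUnion_subset fun G hG => hG.2)⟩
  obtain ⟨G, ⟨u, J, hJ, rfl⟩, hxG⟩ := exists_stratum hΦ hΔ x
  refine ⟨_, ⟨⟨u, J, hJ, rfl⟩, ?_⟩, hxG⟩
  rw [closure_smul_set] at hx ⊢
  rw [Set.mem_smul_set_iff_inv_smul_mem] at hx
  rw [Set.subset_smul_set_iff, ← mul_smul]
  refine smul_cell_subset_closure_cell hΦ hΔ hI hJ (w⁻¹ * u) hx ?_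
  rw [mul_smul]
  exact Set.smul_mem_smul_set hxG

end Strata

end DiagonalStrata
end

theorem theorem3p1 {V : Type*} [NormedAddCommGroup V] [InnerProductSpace ℝ V]
    [FiniteDimensional ℝ V] (Φ Δ : Set V) (hΦ : DiagonalStrata.IsRootSystem Φ)
    (hΔ : DiagonalStrata.IsSimpleSystem Φ Δ) (n : ℕ) (hn : 1 ≤ n) :
    -- (a)
    (∀ I ∈ DiagonalStrata.chains Φ Δ n,
      DiagonalStrata.cell Δ I ⊆ DiagonalStrata.fundRegion Φ Δ n) ∧
    -- (b)
    (∀ I ∈ DiagonalStrata.chains Φ Δ n, ∀ w : DiagonalStrata.reflGroup Φ,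
      ∀ v ∈ w • DiagonalStrata.cell Δ I,
        MulAction.stabilizer (DiagonalStrata.reflGroup Φ) v =
          (DiagonalStrata.parabolic (I (Fin.last n))).map (MulAut.conj w).toMonoidHom) ∧
    -- (c)
    (∀ v w : DiagonalStrata.reflGroup Φ,
      ∀ I ∈ DiagonalStrata.chains Φ Δ n, ∀ J ∈ DiagonalStrata.chains Φ Δ n,
        List.TFAE [
          v • DiagonalStrata.cell Δ I ∩ w • DiagonalStrata.cell Δ J ≠ ∅,
          v • DiagonalStrata.cell Δ I = w • DiagonalStrata.cell Δ J,
          I = J ∧ v⁻¹ * w ∈ DiagonalStrata.parabolic (I (Fin.last n))]) ∧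
    -- (d)
    (∀ I ∈ DiagonalStrata.chains Φ Δ n, ∀ w : DiagonalStrata.reflGroup Φ,
      MulAction.stabilizer (DiagonalStrata.reflGroup Φ) (w • DiagonalStrata.cell Δ I) =
        (DiagonalStrata.parabolic (I (Fin.last n))).map (MulAut.conj w).toMonoidHom) ∧
    -- (e)
    (DiagonalStrata.IsDisjointUnionOfStrata Φ Δ (DiagonalStrata.fundRegion Φ Δ n) ∧
      DiagonalStrata.IsDisjointUnionOfStrata Φ Δ (Set.univ : Set (Fin n → V))) ∧
    -- (f)
    (∀ F ∈ DiagonalStrata.strata Φ Δ n,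
      ∃ 𝒢 ⊆ DiagonalStrata.strata Φ Δ n, closure F = ⋃₀ 𝒢) :=
  ⟨fun _ hI => DiagonalStrata.cell_subset_fundRegion hΦ hΔ hI,
    fun _ hI w _ hv => DiagonalStrata.stabilizer_of_mem_smul_cell hΦ hΔ hI w hv,
    fun v w _ hI _ hJ => DiagonalStrata.strata_tfae hΦ hΔ v w hI hJ,
    fun _ hI w => DiagonalStrata.stabilizer_smul_cell hΦ hΔ hI w,
    ⟨DiagonalStrata.isDisjointUnionOfStrata_fundRegion hΦ hΔ,
      DiagonalStrata.isDisjointUnionOfStrata_univ hΦ hΔ⟩,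
    fun _ hF => DiagonalStrata.exists_closure_eq_sUnion hΦ hΔ hF⟩
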